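/- Let $k$ be a field. A standard graded $k$-algebra is a commutative graded $k$-algebra $R=\bigoplus_{n\ge 0}R_n$ with $R_0=k$ and $\dim_k R_1<\infty$ that is generated by $R_1$ as a $k$-algebra. Its Hilbert series is $H_R(t)=\sum_{n\ge 0}\dim_k(R_n)\,t^n\in\mathbb Z[[t]]$. The algebra $R$ is called Koszul if the graded $R$-module $k=R/R_{\ge 1}$, placed in degree $0$, has a linear graded free resolution, that is, a graded resolution by free $R$-modules of finite rank whose differentials are described by matrices all of whose non-zero entries are linear forms (elements of $R_1$). If $R$ is a standard graded $k$-algebra with Hilbert series $$H_R(t)=\frac{1+2t-2t^3}{1-t},$$ then $R$ is not Koszul. -/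

import Mathlib

/-- `R = ⨁ 𝒜 n` is a standard graded `k`-algebra: `R₀ = k` (that is, `k → R` is injective with
image `𝒜 0`), `dim_k R₁ < ∞`, and `R` is generated by `R₁` as a `k`-algebra. -/
structure IsStandardGraded {k R : Type*} [Field k] [CommRing R] [Algebra k R]
    (𝒜 : ℕ → Submodule k R) [GradedAlgebra 𝒜] : Prop where
  algebraMap_injective : Function.Injective (algebraMap k R)
  degree_zero : 𝒜 0 = (⊥ : Subalgebra k R).toSubmodule
  finite_degree_one : FiniteDimensional k (𝒜 1)
  adjoin_degree_one : Algebra.adjoin k (𝒜 1 : Set R) = ⊤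

/-- The Hilbert series `∑ₙ dim_k (Rₙ) tⁿ`. The dimensions are all finite when `R` is standard
graded. -/
noncomputable def gradedHilbertSeries {k R : Type*} [Field k] [CommRing R] [Algebra k R]
    (𝒜 : ℕ → Submodule k R) : PowerSeries ℤ :=
  PowerSeries.mk fun n => (Module.finrank k (𝒜 n) : ℤ)

/-- A graded free resolution
`⋯ → R^(rank 2) → R^(rank 1) → R^(rank 0) → M → 0`
of the `R`-module `M` with grading `ℳ`, by free modules of finite rank, with all matrices linear.
The `a`-th basis vector of the `i`-th free module is homogeneous of degree `deg i a`, and all maps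
are homogeneous of degree zero. -/
structure LinearFreeResolution {k R : Type*} [Field k] [CommRing R] [Algebra k R]
    (𝒜 : ℕ → Submodule k R) {M : Type*} [AddCommGroup M] [Module R M]
    (ℳ : ℤ → AddSubgroup M) where
  rank : ℕ → ℕ
  deg : (i : ℕ) → Fin (rank i) → ℤ
  d : (i : ℕ) → Matrix (Fin (rank i)) (Fin (rank (i + 1))) R
  ε : (Fin (rank 0) → R) →ₗ[R] M
  ε_surjective : Function.Surjective ε
  exact_zero : Function.Exact (d 0).mulVecLin ε
  exact_succ : ∀ i, Function.Exact (d (i + 1)).mulVecLin (d i).mulVecLin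
  ε_homogeneous : ∀ a, ε (Pi.single a 1) ∈ ℳ (deg 0 a)
  d_linear : ∀ i a b, d i a b ∈ 𝒜 1
  d_homogeneous : ∀ i a b, d i a b ≠ 0 → deg (i + 1) b = deg i a + 1

/-- A graded `R`-module `M` is linear if it admits a graded free resolution with maps described by
matrices whose non-zero entries are linear forms. -/
def IsLinearModule {k R : Type*} [Field k] [CommRing R] [Algebra k R]
    (𝒜 : ℕ → Submodule k R) {M : Type*} [AddCommGroup M] [Module R M]
    (ℳ : ℤ → AddSubgroup M) : Prop :=
  Nonempty (LinearFreeResolution 𝒜 ℳ)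

/-- The grading of a module that is concentrated in degree zero. -/
def gradingInDegreeZero (M : Type*) [AddCommGroup M] (n : ℤ) : AddSubgroup M :=
  if n = 0 then ⊤ else ⊥

/-- `R` is Koszul if the residue field, the `R`-module `R / R_{≥ 1}` in degree zero, is linear. -/
def IsKoszulAlgebra {k R : Type*} [Field k] [CommRing R] [Algebra k R]
    (𝒜 : ℕ → Submodule k R) [GradedAlgebra 𝒜] : Prop :=
  IsLinearModule 𝒜
    (gradingInDegreeZero (R ⧸ (HomogeneousIdeal.irrelevant 𝒜).toIdeal))

/-! Let `h n` be the dimension of `𝒜 n`; the Hilbert series gives 1, 3, 3, 1, 1, .... If `k` has a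
linear resolution with ranks `β i`, it splits by coordinate degree into exact complexes of
finite-dimensional spaces, and the power series identity `P(t) H(-t) = 1` follows for `P = ∑ β i
t^i`. Here `P = (1 + t) / (1 - 2t + 2t³)`, whose coefficient at `t^7` is `-4`, impossible for a
rank.

Instead of power series, the proof tracks image dimensions of the differentials: `imageDim_add` is
rank-nullity on one graded piece. The boundary values come from `linearMatrixMap_range_eq_top` and
`rank_mul_finrank_degree_zero`. -/

open DirectSum HomogeneousIdeal

section LinearMatrix

variable {k R : Type*} [Field k] [CommRing R] [Algebra k R]
  (𝒜 : ℕ → Submodule k R) [GradedAlgebra 𝒜]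
  {m l : ℕ} (D : Matrix (Fin m) (Fin l) R) (hD : ∀ a b, D a b ∈ 𝒜 1)

/-- The map `(𝒜 n)^l → (𝒜 (n+1))^m` given by a matrix of linear forms. -/
def linearMatrixMap (n : ℕ) : (Fin l → 𝒜 n) →ₗ[k] (Fin m → 𝒜 (n + 1)) where
  toFun x a := ⟨∑ b, D a b * (x b : R), Submodule.sum_mem _ fun b _ => by
    have h := SetLike.GradedMul.mul_mem (hD a b) (x b).2
    rwa [add_comm] at h⟩
  map_add' x y := by
    ext a
    simp [mul_add, Finset.sum_add_distrib]
  map_smul' c x := by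
    ext a
    simp [Finset.smul_sum]

theorem mulVecLin_coe_eq (n : ℕ) (x : Fin l → 𝒜 n) (a : Fin m) :
    D.mulVecLin (fun b => (x b : R)) a = (linearMatrixMap 𝒜 D hD n x a : R) := rfl

theorem decompose_mulVecLin_zero (hD : ∀ a b, D a b ∈ 𝒜 1) (y : Fin l → R) (a : Fin m) :
    (decompose 𝒜 (D.mulVecLin y a) 0 : R) = 0 := by
  simp only [Matrix.mulVecLin_apply, Matrix.mulVec, dotProduct, decompose_sum,
    DirectSum.sum_apply, AddSubmonoidClass.coe_finsetSum]
  exact Finset.sum_eq_zero fun b _ =>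
    coe_decompose_mul_of_left_mem_of_not_le 𝒜 (hD a b) (by omega)

theorem decompose_mulVecLin_succ (n : ℕ) (y : Fin l → R) (a : Fin m) :
    (decompose 𝒜 (D.mulVecLin y a) (n + 1) : R) =
      linearMatrixMap 𝒜 D hD n (fun b => decompose 𝒜 (y b) n) a := by
  simp only [Matrix.mulVecLin_apply, Matrix.mulVec, dotProduct, decompose_sum,
    DirectSum.sum_apply, AddSubmonoidClass.coe_finsetSum, linearMatrixMap, LinearMap.coe_mk,
    AddHom.coe_mk]
  exact Finset.sum_congr rfl fun b _ =>
    coe_decompose_mul_of_left_mem_of_le 𝒜 (hD a b) (by omega)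

/-- A homogeneous vector of degree zero in the image of a matrix of linear forms vanishes. -/
theorem eq_zero_of_mem_range_mulVecLin (hD : ∀ a b, D a b ∈ 𝒜 1) (x : Fin m → 𝒜 0)
    (hx : (fun a => (x a : R)) ∈ Set.range D.mulVecLin) : x = 0 := by
  obtain ⟨y, hy⟩ := hx
  ext a
  have h := decompose_mulVecLin_zero 𝒜 D hD y a
  rw [hy] at h
  simpa using h

/-- A homogeneous vector of positive degree in the image of a matrix of linear forms has a
homogeneous preimage. -/
theorem mem_range_linearMatrixMap {n : ℕ} (x : Fin m → 𝒜 (n + 1))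
    (hx : (fun a => (x a : R)) ∈ Set.range D.mulVecLin) :
    x ∈ LinearMap.range (linearMatrixMap 𝒜 D hD n) := by
  obtain ⟨y, hy⟩ := hx
  refine ⟨fun b => decompose 𝒜 (y b) n, ?_⟩
  ext a
  rw [← decompose_mulVecLin_succ, hy]
  simp

variable {p : ℕ} (E : Matrix (Fin l) (Fin p) R)

/-- This is minimality of the resolution: by exactness a kernel vector lies in the image of the
linear matrix `E`, which has no component in degree zero. -/
theorem linearMatrixMap_ker_zero (hDE : Function.Exact E.mulVecLin D.mulVecLin)
    (hE : ∀ a b, E a b ∈ 𝒜 1) : LinearMap.ker (linearMatrixMap 𝒜 D hD 0) = ⊥ := by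
  refine (Submodule.eq_bot_iff _).2 fun x hx => eq_zero_of_mem_range_mulVecLin 𝒜 E hE x ?_
  refine (hDE _).1 (funext fun a => ?_)
  rw [mulVecLin_coe_eq 𝒜 D hD, LinearMap.mem_ker.1 hx]
  rfl

theorem linearMatrixMap_ker_succ (hE : ∀ a b, E a b ∈ 𝒜 1)
    (hDE : Function.Exact E.mulVecLin D.mulVecLin) (n : ℕ) :
    LinearMap.ker (linearMatrixMap 𝒜 D hD (n + 1)) =
      LinearMap.range (linearMatrixMap 𝒜 E hE n) := by
  ext x
  constructor
  · intro hx
    refine mem_range_linearMatrixMap 𝒜 E hE x ((hDE _).1 (funext fun a => ?_))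
    rw [mulVecLin_coe_eq 𝒜 D hD, LinearMap.mem_ker.1 hx]
    rfl
  · rintro ⟨y, rfl⟩
    ext a
    rw [← mulVecLin_coe_eq 𝒜 D hD]
    exact congrFun ((hDE _).2 ⟨fun b => (y b : R), rfl⟩) a

end LinearMatrix

section Residue

variable {k R : Type*} [Field k] [CommRing R] [Algebra k R]
  (𝒜 : ℕ → Submodule k R) [GradedAlgebra 𝒜]

variable {r : ℕ} (ε : (Fin r → R) →ₗ[R] R ⧸ (irrelevant 𝒜).toIdeal)

/-- A map out of a free module, restricted to the vectors of degree zero. -/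
def degreeZeroPart : (Fin r → 𝒜 0) →ₗ[k] R ⧸ (irrelevant 𝒜).toIdeal :=
  (ε.restrictScalars k).comp (LinearMap.pi fun a => (𝒜 0).subtype.comp (LinearMap.proj a))

theorem apply_eq_zero_of_mem_irrelevant (x : Fin r → R)
    (hx : ∀ a, x a ∈ (irrelevant 𝒜).toIdeal) : ε x = 0 := by
  rw [← Finset.univ_sum_single x, map_sum]
  refine Finset.sum_eq_zero fun a _ => ?_
  have h : (Pi.single a (x a) : Fin r → R) = x a • Pi.single a 1 := by
    rw [← Pi.single_smul, smul_eq_mul, mul_one]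
  rw [h, map_smul]
  obtain ⟨y, hy⟩ := Ideal.Quotient.mk_surjective (ε (Pi.single a 1))
  rw [← hy]
  exact Ideal.Quotient.eq_zero_iff_mem.2 (Ideal.mul_mem_right y _ (hx a))

theorem sub_decompose_zero_mem_irrelevant (x : R) :
    x - (decompose 𝒜 x 0 : R) ∈ (irrelevant 𝒜).toIdeal := by
  change (decompose 𝒜 (x - (decompose 𝒜 x 0 : R)) 0 : R) = 0
  simp [decompose_sub]

theorem degreeZeroPart_surjective (hε : Function.Surjective ε) :
    Function.Surjective (degreeZeroPart 𝒜 ε) := by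
  intro z
  obtain ⟨x, rfl⟩ := hε z
  refine ⟨fun a => decompose 𝒜 (x a) 0, ?_⟩
  have h := apply_eq_zero_of_mem_irrelevant 𝒜 ε (fun a => x a - (decompose 𝒜 (x a) 0 : R))
    fun a => sub_decompose_zero_mem_irrelevant 𝒜 (x a)
  have h' : (fun a => x a - (decompose 𝒜 (x a) 0 : R)) = x - fun a => (decompose 𝒜 (x a) 0 : R) :=
    rfl
  rw [h', map_sub, sub_eq_zero] at h
  exact h.symm

/-- The kernel of `ε` is the image of a linear matrix, so it contains no nonzero vector of degree
zero. -/
theorem degreeZeroPart_injective {l : ℕ} (D : Matrix (Fin r) (Fin l) R)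
    (hD : ∀ a b, D a b ∈ 𝒜 1) (hex : Function.Exact D.mulVecLin ε) :
    Function.Injective (degreeZeroPart 𝒜 ε) := by
  refine (injective_iff_map_eq_zero _).2 fun x hx => ?_
  exact eq_zero_of_mem_range_mulVecLin 𝒜 D hD x ((hex _).1 hx)

/-- The residue field `R / R_{≥ 1}` has the dimension of `R₀`. -/
theorem finrank_quotient_irrelevant :
    Module.finrank k (R ⧸ (irrelevant 𝒜).toIdeal) = Module.finrank k (𝒜 0) := by
  let f : 𝒜 0 →ₗ[k] R ⧸ (irrelevant 𝒜).toIdeal :=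
    (Ideal.Quotient.mkₐ k (irrelevant 𝒜).toIdeal).toLinearMap.comp (𝒜 0).subtype
  refine (LinearEquiv.ofBijective f ⟨?_, ?_⟩).finrank_eq.symm
  · refine (injective_iff_map_eq_zero _).2 fun x hx => ?_
    have h : (x : R) ∈ (irrelevant 𝒜).toIdeal := Ideal.Quotient.eq_zero_iff_mem.1 hx
    have h' : (decompose 𝒜 (x : R) 0 : R) = 0 := h
    simpa using h'
  · intro z
    obtain ⟨x, rfl⟩ := Ideal.Quotient.mk_surjective z
    exact ⟨decompose 𝒜 x 0, (Ideal.Quotient.eq.2 (sub_decompose_zero_mem_irrelevant 𝒜 x)).symm⟩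

theorem rank_mul_finrank_degree_zero {l : ℕ} (D : Matrix (Fin r) (Fin l) R)
    (hD : ∀ a b, D a b ∈ 𝒜 1) (hex : Function.Exact D.mulVecLin ε)
    (hε : Function.Surjective ε) [FiniteDimensional k (𝒜 0)] :
    r * Module.finrank k (𝒜 0) = Module.finrank k (𝒜 0) := by
  have h := (LinearEquiv.ofBijective (degreeZeroPart 𝒜 ε)
    ⟨degreeZeroPart_injective 𝒜 ε D hD hex, degreeZeroPart_surjective 𝒜 ε hε⟩).finrank_eq
  rw [finrank_quotient_irrelevant, Module.finrank_pi_fintype] at h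
  simpa using h

/-- If `D` is the first matrix of a linear presentation of the residue field, then in positive
degrees its image is everything. -/
theorem linearMatrixMap_range_eq_top {l : ℕ} (D : Matrix (Fin r) (Fin l) R)
    (hD : ∀ a b, D a b ∈ 𝒜 1) (hex : Function.Exact D.mulVecLin ε) (n : ℕ) :
    LinearMap.range (linearMatrixMap 𝒜 D hD n) = ⊤ := by
  refine eq_top_iff.2 fun x _ => mem_range_linearMatrixMap 𝒜 D hD x ((hex _).1 ?_)
  exact apply_eq_zero_of_mem_irrelevant 𝒜 ε _ fun a =>
    mem_irrelevant_of_mem 𝒜 n.succ_pos (x a).2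

end Residue

section Betti

variable {k R : Type*} [Field k] [CommRing R] [Algebra k R]
  {𝒜 : ℕ → Submodule k R} [GradedAlgebra 𝒜] {M : Type*} [AddCommGroup M] [Module R M]
  {ℳ : ℤ → AddSubgroup M} (F : LinearFreeResolution 𝒜 ℳ)

/-- The dimension of the image of the `i`-th differential in degree `n + 1`. -/
noncomputable def LinearFreeResolution.imageDim (i n : ℕ) : ℕ :=
  Module.finrank k (LinearMap.range (linearMatrixMap 𝒜 (F.d i) (F.d_linear i) n))

theorem LinearFreeResolution.imageDim_zero_right [FiniteDimensional k (𝒜 0)] (i : ℕ) :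
    F.imageDim i 0 = F.rank (i + 1) * Module.finrank k (𝒜 0) := by
  have h := LinearMap.finrank_range_add_finrank_ker
    (linearMatrixMap 𝒜 (F.d i) (F.d_linear i) 0)
  rw [linearMatrixMap_ker_zero 𝒜 _ _ _ (F.exact_succ i) (F.d_linear (i + 1)), finrank_bot,
    Module.finrank_pi_fintype] at h
  simpa [imageDim] using h

theorem LinearFreeResolution.imageDim_add [∀ n, FiniteDimensional k (𝒜 n)] (i n : ℕ) :
    F.imageDim i (n + 1) + F.imageDim (i + 1) n =
      F.rank (i + 1) * Module.finrank k (𝒜 (n + 1)) := by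
  have h := LinearMap.finrank_range_add_finrank_ker
    (linearMatrixMap 𝒜 (F.d i) (F.d_linear i) (n + 1))
  rw [linearMatrixMap_ker_succ 𝒜 _ _ _ (F.d_linear (i + 1)) (F.exact_succ i),
    Module.finrank_pi_fintype] at h
  simpa [imageDim] using h

end Betti

section HilbertSeries

variable {k R : Type*} [Field k] [CommRing R] [Algebra k R] {𝒜 : ℕ → Submodule k R}

/-- Multiplying by `1 - X` takes successive differences, so the dimensions are the partial sums of
1, 2, 0, -2, 0, .... -/
theorem finrank_of_gradedHilbertSeries
    (hH : gradedHilbertSeries 𝒜 * (1 - PowerSeries.X)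
      = 1 + 2 * PowerSeries.X - 2 * PowerSeries.X ^ 3) (n : ℕ) :
    Module.finrank k (𝒜 n) = if n = 1 ∨ n = 2 then 3 else 1 := by
  have h2 : (2 : PowerSeries ℤ) = PowerSeries.C 2 := rfl
  induction n with
  | zero =>
    have h := congrArg (PowerSeries.coeff 0) hH
    simp [gradedHilbertSeries] at h
    simpa using h
  | succ n ih =>
    have h := congrArg (PowerSeries.coeff (n + 1)) hH
    rw [mul_sub, mul_one, map_sub, PowerSeries.coeff_succ_mul_X, h2, map_sub, map_add,
      PowerSeries.coeff_C_mul, PowerSeries.coeff_C_mul, PowerSeries.coeff_X,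
      PowerSeries.coeff_X_pow, PowerSeries.coeff_one] at h
    simp only [gradedHilbertSeries, PowerSeries.coeff_mk, ih] at h
    rcases n with _ | _ | _ | n <;> simp at h ⊢ <;> omega

end HilbertSeries

theorem mainTheorem10 {k R : Type*} [Field k] [CommRing R] [Algebra k R]
    (𝒜 : ℕ → Submodule k R) [GradedAlgebra 𝒜] (hR : IsStandardGraded 𝒜)
    (hH : gradedHilbertSeries 𝒜 * (1 - PowerSeries.X)
      = 1 + 2 * PowerSeries.X - 2 * PowerSeries.X ^ 3) :
    ¬ IsKoszulAlgebra 𝒜 := by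
  rintro ⟨F⟩
  have hfin := finrank_of_gradedHilbertSeries hH
  -- `finrank` is zero in infinite dimension, so its positive values force finiteness.
  have hfd (n : ℕ) : FiniteDimensional k (𝒜 n) :=
    FiniteDimensional.of_finrank_pos (by rw [hfin]; split_ifs <;> norm_num)
  have h0 : F.rank 0 = 1 := by
    simpa [hfin] using
      rank_mul_finrank_degree_zero 𝒜 F.ε (F.d 0) (F.d_linear 0) F.exact_zero F.ε_surjective
  have hfirst (n : ℕ) : F.imageDim 0 n = Module.finrank k (𝒜 (n + 1)) := by
    rw [LinearFreeResolution.imageDim,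
      linearMatrixMap_range_eq_top 𝒜 F.ε (F.d 0) (F.d_linear 0) F.exact_zero, finrank_top,
      Module.finrank_pi_fintype]
    simp [h0]
  have hzero (i : ℕ) : F.imageDim i 0 = F.rank (i + 1) := by
    simpa [hfin] using F.imageDim_zero_right i
  have hone (i : ℕ) : F.imageDim i 1 + F.imageDim (i + 1) 0 = F.rank (i + 1) * 3 := by
    simpa [hfin] using F.imageDim_add i 0
  have htwo (i : ℕ) : F.imageDim i 2 + F.imageDim (i + 1) 1 = F.rank (i + 1) * 3 := by
    simpa [hfin] using F.imageDim_add i 1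
  have hlarge (i n : ℕ) : F.imageDim i (n + 3) + F.imageDim (i + 1) (n + 2) = F.rank (i + 1) := by
    simpa [hfin] using F.imageDim_add i (n + 2)
  simp only [hfin] at hfirst
  -- The relations determine the Betti numbers `1, 3, 6, 10, 14, 16, 12, -4`.
  have f0 := hfirst 0
  have f1 := hfirst 1
  have f2 := hfirst 2
  have f3 := hfirst 3
  have f4 := hfirst 4
  have f5 := hfirst 5
  have f6 := hfirst 6
  norm_num at f0 f1 f2 f3 f4 f5 f6
  have e1 := hone 0
  have e2 := hone 1
  have e3 := hone 2
  have e4 := hone 3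
  have e5 := hone 4
  have e6 := hone 5
  have t1 := htwo 0
  have t2 := htwo 1
  have t3 := htwo 2
  have t4 := htwo 3
  have t5 := htwo 4
  have l03 := hlarge 0 0
  have l04 := hlarge 0 1
  have l05 := hlarge 0 2
  have l06 := hlarge 0 3
  have l13 := hlarge 1 0
  have l14 := hlarge 1 1
  have l15 := hlarge 1 2
  have l23 := hlarge 2 0
  have l24 := hlarge 2 1
  have l33 := hlarge 3 0
  simp only [hzero, Nat.reduceAdd, zero_add] at *
  -- On the diagonal `i + n = 6`, `imageDim i n` for `i = 0, ..., 5` is 1, 2, 4, 6, 8, 40. Then `e6`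
  -- reads `40 + F.rank 7 = 12 * 3`, which has no solution in `ℕ`.
  omega
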